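/- For a pointed topological space $(X,x_0)$ and $m\ge 1$ let $\tau_m(X)=\tau_m(X,x_0)=\pi_1\bigl(X^{T^{m-1}},\overline{x_0}\bigr)$ be the $m$-th Fox torus homotopy group, where $X^{T^{m-1}}$ is the space of all (unbased) continuous maps from the $(m-1)$-torus $T^{m-1}=(S^1)^{m-1}$ to $X$ with the compact-open topology, and $\overline{x_0}$ is the constant map at $x_0$. For $n\ge1$ and a group $\pi$, a space of type $K(\pi,n)$ is a path-connected topological space $X$ with $\pi_n(X)\cong\pi$ and $\pi_k(X)=1$ for all $k\geq 1$, $k\ne n$. (1) Let $n\ge 2$, let $\pi$ be an abelian group, and let $X$ be a space of type $K(\pi,n)$ with any base point. Then $\tau_m(X)\cong\pi_m(X)$ for $1\le m\le n$; for every $k\ge 0$, $$\tau_{n+k}(X)\cong\bigoplus_{j=0}^{k}\pi_n(X)^{\binom{n-2+j}{n-2}},\qquad \sum_{j=0}^{k}\binom{n-2+j}{n-2}=\binom{n+k-1}{k};$$ and therefore, for $m\ge 1$, $$\tau_m(X)\cong\begin{cases}1,&\text{if } m<n,\\ \pi^{\binom{m-1}{m-n}},&\text{if } m\ge n.\end{cases}$$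 (2) Let $\pi$ be any group and let $X$ be a space of type $K(\pi,1)$ with any base point. Then $\tau_k(X)\cong\pi$ for all $k\ge 1$. -/

import Mathlib

open scoped Topology

universe u v

/-- The Fox torus homotopy group `τ_m(X, x₀) = π₁(X^{T^{m-1}}, const x₀)`, for `m ≥ 1`.
Here `X^{T^{m-1}}` is the space of all (unbased) continuous maps from the `(m-1)`-torus
`(ℝ/ℤ)^{m-1}` to `X` with the compact-open topology, and the base point is the constant map
at `x₀`. -/
abbrev FoxTorusGroup (m : ℕ) (X : Type u) [TopologicalSpace X] (x₀ : X) : Type u :=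
  FundamentalGroup C(UnitAddTorus (Fin (m - 1)), X) (ContinuousMap.const _ x₀)

/-- `X` is an Eilenberg–MacLane space of type `(G, n)`, `n ≥ 1`: it is path connected, its `n`-th
homotopy group is isomorphic to `G`, and all its other homotopy groups are trivial. -/
structure IsEilenbergMacLane (G : Type v) [Group G] (n : ℕ) [NeZero n]
    (X : Type u) [TopologicalSpace X] : Prop where
  pathConnected : PathConnectedSpace X
  nonempty_mulEquiv : ∀ x : X, Nonempty (π_ n X x ≃* G)
  subsingleton_of_ne : ∀ (k : ℕ) [NeZero k], k ≠ n → ∀ x : X, Subsingleton (π_ k X x)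

/-!
Evaluation of free loops at the base point gives an extension `1 → π₁(ΩX) → π₁(LX) → π₁(X) → 1`,
split by the constant loops. Applied to the space of maps from a torus, whose loops are the maps
from that torus to `ΩX`, it becomes the split extension `1 → τ_m(ΩX) → τ_{m+1}(X) → τ_m(X) → 1`.

If `X` is a `K(G, n)`, then `ΩX` is a `K(G, n - 1)`. Hence, as soon as these extensions are direct
products, the number of copies of `G` in `τ_m(X)` satisfies Pascal's rule. For `n ≥ 2` they are
direct products because `τ_m(X)` is abelian. Up to degree `n` this holds since `τ_m(X) ≅ π_m(X)`.
Beyond it, iterating the extension shows that an element of `τ_{m+1}(X)` with trivial restriction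
to every coordinate face of the torus comes from `π_{m+1}(X) = 1`, and by induction commutators
have trivial restrictions.
-/

open scoped unitInterval

section PathSpaces

variable {X : Type*} [TopologicalSpace X] {x y z : X}

theorem pathHomotopic_iff_joined {p q : Path x y} : p.Homotopic q ↔ Joined p q := by
  refine ⟨fun ⟨H⟩ => ⟨⟨⟨H.eval, ?_⟩, H.eval_zero, H.eval_one⟩⟩, fun ⟨γ⟩ => ⟨?_⟩⟩
  · exact Path.continuous_uncurry_iff.1 H.continuous
  · exact
      { toFun := fun st => γ st.1 st.2
        continuous_toFun := by fun_prop
        map_zero_left := fun t => by simp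
        map_one_left := fun t => by simp
        prop' := by
          rintro s t (rfl | rfl) <;> simp }

theorem map_homotopic_refl_of_joined_const {K : Type*} [TopologicalSpace K]
    [LocallyCompactSpace K] {f : C(K, X)} (h : Joined f (.const K x)) {k : K} (p : Path k k) :
    (p.map f.continuous).Homotopic (.refl (f k)) := by
  obtain ⟨γ⟩ := h
  let H : f.Homotopy (.const K x) :=
    { toFun := fun sk => γ sk.1 sk.2
      map_zero_left := by simp
      map_one_left := by simp }
  rw [← Path.Homotopic.Quotient.eq]
  have hH : (Path.Homotopic.Quotient.mk (p.map f.continuous)).trans (.mk (H.evalAt k)) =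
      (Path.Homotopic.Quotient.mk (H.evalAt k)).trans (.refl x) :=
    Path.Homotopic.Quotient.eq.2 (Path.Homotopic.map_trans_evalAt H p)
  simpa [Path.Homotopic.Quotient.trans_assoc] using
    congrArg (fun P => P.trans (.symm (.mk (H.evalAt k)))) hH

/-- Paths between constant maps, in a space of continuous maps on `K`, are continuous families of
paths parametrized by `K`. -/
def pathSwap (K : Type*) [TopologicalSpace K] [LocallyCompactSpace K] :
    Path (ContinuousMap.const K x) (.const K y) ≃ₜ C(K, Path x y) where
  toFun γ :=
    { toFun := fun k => ⟨⟨fun t => γ t k, by fun_prop⟩, by simp, by simp⟩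
      continuous_toFun := Path.continuous_uncurry_iff.1
        (by dsimp [Function.HasUncurry.uncurry]; fun_prop) }
  invFun f :=
    { toFun := fun t => ⟨fun k => f k t, by fun_prop⟩
      continuous_toFun := ContinuousMap.continuous_of_continuous_uncurry _
        (by dsimp [Function.uncurry]; fun_prop)
      source' := by ext; simp
      target' := by ext; simp }
  left_inv _ := rfl
  right_inv _ := rfl
  continuous_toFun := ContinuousMap.continuous_of_continuous_uncurry _
    (Path.continuous_uncurry_iff.1
      (by dsimp [Function.HasUncurry.uncurry, Function.uncurry]; fun_prop))
  continuous_invFun := Path.continuous_uncurry_iff.1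
    (ContinuousMap.continuous_of_continuous_uncurry _
      (by dsimp [Function.HasUncurry.uncurry]; fun_prop))

theorem pathSwap_apply (K : Type*) [TopologicalSpace K] [LocallyCompactSpace K]
    (γ : Path (ContinuousMap.const K x) (.const K y)) (k : K) (t : I) :
    pathSwap K γ k t = γ t k := rfl

/-- The interchange of the two coordinates of a double loop. -/
def loopTranspose : C(Path (Path.refl x) (Path.refl x), Path (Path.refl x) (Path.refl x)) where
  toFun q :=
    { toFun := fun t => ⟨⟨fun s => q s t, by fun_prop⟩, by simp, by simp⟩
      continuous_toFun := Path.continuous_uncurry_iff.1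
        (by dsimp [Function.HasUncurry.uncurry]; fun_prop)
      source' := by ext; simp
      target' := by ext; simp }
  continuous_toFun := Path.continuous_uncurry_iff.1 (Path.continuous_uncurry_iff.1
    (by dsimp [Function.HasUncurry.uncurry]; fun_prop))

end PathSpaces

section Circle

/-- The standard loop on the circle `ℝ/ℤ`. -/
def circleLoop : Path (0 : UnitAddCircle) 0 where
  toFun t := ((t : ℝ) : UnitAddCircle)
  source' := by simp
  target' := AddCircle.coe_period (1 : ℝ)

theorem circleLoop_apply (t : I) : circleLoop t = ((t : ℝ) : UnitAddCircle) := rfl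

theorem circleLoop_surjective : Function.Surjective circleLoop := fun z => by
  obtain ⟨t, ht, rfl⟩ := (AddCircle.coe_image_Icc_eq (1 : ℝ) 0).symm ▸ Set.mem_univ z
  exact ⟨⟨t, by simpa using ht⟩, rfl⟩

-- The quotient map `I → S¹` is proper, so it stays a quotient map after a product with `Y`.
theorem isQuotientMap_prodMap_id_circleLoop (Y : Type*) [TopologicalSpace Y] :
    Topology.IsQuotientMap (Prod.map (id : Y → Y) circleLoop) :=
  (isProperMap_id.prodMap circleLoop.continuous.isProperMap).isClosedMap.isQuotientMap
    (by fun_prop) (Function.surjective_id.prodMap circleLoop_surjective)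

variable {X : Type*} [TopologicalSpace X] {x y : X}

theorem liftIco_extend_circleLoop (p : Path x x) (t : I) :
    AddCircle.liftIco 1 0 p.extend (circleLoop t) = p t := by
  rcases t.2.2.eq_or_lt with ht | ht
  · obtain rfl : t = 1 := Subtype.ext ht
    rw [circleLoop.target, p.target, ← AddCircle.coe_zero,
      AddCircle.liftIco_zero_coe_apply (by simp), p.extend_zero]
  · rw [circleLoop_apply, AddCircle.liftIco_zero_coe_apply ⟨t.2.1, ht⟩, p.extend_apply]

/-- The map on the circle that is induced by a loop. -/
noncomputable def circleLift : C(Path x x, C(UnitAddCircle, X)) :=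
  ContinuousMap.curry ⟨fun z : Path x x × UnitAddCircle => AddCircle.liftIco 1 0 z.1.extend z.2, by
    refine (isQuotientMap_prodMap_id_circleLoop _).continuous_iff.2 ?_
    simp only [Function.comp_def, Prod.map, id, liftIco_extend_circleLoop]
    fun_prop⟩

@[simp]
theorem circleLift_circleLoop (p : Path x x) (t : I) : circleLift p (circleLoop t) = p t :=
  liftIco_extend_circleLoop p t

@[simp]
theorem circleLift_zero (p : Path x x) : circleLift p 0 = x := by
  rw [← circleLoop.source, circleLift_circleLoop, p.source]

theorem continuousMap_circle_ext {f g : C(UnitAddCircle, X)}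
    (h : ∀ t, f (circleLoop t) = g (circleLoop t)) : f = g :=
  ContinuousMap.ext (circleLoop_surjective.forall.2 h)

theorem circleLift_refl : circleLift (Path.refl x) = .const _ x :=
  continuousMap_circle_ext fun t => by simp

theorem circleLift_map_circleLoop (f : C(UnitAddCircle, X)) :
    circleLift (circleLoop.map f.continuous) = f :=
  continuousMap_circle_ext fun t => by simp

theorem joined_circleLift_trans_comm (a : Path x y) (b : Path y x) :
    Joined (circleLift (a.trans b)) (circleLift (b.trans a)) := by
  let rotation (s : I) : C(UnitAddCircle, X) :=
    (circleLift (a.trans b)).comp ⟨fun z => z + ((s / 2 : ℝ) : UnitAddCircle), by fun_prop⟩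
  refine ⟨⟨⟨rotation, ?_⟩, ?_, continuousMap_circle_ext fun t => ?_⟩⟩
  · exact ContinuousMap.continuous_of_continuous_uncurry _
      (by dsimp [Function.uncurry, rotation]; fun_prop)
  · ext z; simp [rotation]
  have hrot : rotation 1 (circleLoop t) =
      circleLift (a.trans b) ((t + 1 / 2 : ℝ) : UnitAddCircle) := by
    simp [rotation, circleLoop_apply]
  rw [hrot, circleLift_circleLoop, Path.trans_apply]
  split_ifs with ht
  · have hI : (t + 1 / 2 : ℝ) ∈ I := ⟨by linarith [t.2.1], by linarith⟩
    rw [← circleLoop_apply ⟨_, hI⟩, circleLift_circleLoop, Path.trans_apply]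
    split_ifs with h0
    · have : (t : ℝ) = 0 := le_antisymm (by simpa using h0) t.2.1
      simp [this]
    · congr 1; ext; push_cast; ring
  · have hI : (t - 1 / 2 : ℝ) ∈ I := ⟨by linarith, by linarith [t.2.2]⟩
    have hper : ((t + 1 / 2 : ℝ) : UnitAddCircle) = ((t - 1 / 2 : ℝ) : UnitAddCircle) := by
      rw [← AddCircle.coe_add_period 1 (t - 1 / 2 : ℝ)]; ring_nf
    rw [hper, ← circleLoop_apply ⟨_, hI⟩, circleLift_circleLoop, Path.trans_apply,
      dif_pos (by dsimp; linarith [t.2.2])]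
    congr 1; ext; push_cast; ring

theorem joined_circleLift_conj (p : Path x x) (h : Path x y) :
    Joined (circleLift p) (circleLift (h.symm.trans (p.trans h))) := by
  refine .trans (Joined.map ?_ circleLift.continuous)
    (joined_circleLift_trans_comm (p.trans h) h.symm)
  rw [← pathHomotopic_iff_joined, ← Path.Homotopic.Quotient.eq]
  simp [Path.Homotopic.Quotient.mk_trans, Path.Homotopic.Quotient.mk_symm]

theorem homotopic_refl_of_joined_circleLift_const {p : Path x x} {c : X}
    (h : Joined (circleLift p) (.const _ c)) : p.Homotopic (.refl x) := by
  have hx : x = circleLift p 0 := (circleLift_zero p).symm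
  have hp : (circleLoop.map (circleLift p).continuous).cast hx hx = p := by ext; simp
  have hrefl : (Path.refl (circleLift p 0)).cast hx hx = .refl x := by ext; exact hx.symm
  simpa only [hp, hrefl] using (map_homotopic_refl_of_joined_const h circleLoop).pathCast hx hx

end Circle

section FundamentalGroup

open FundamentalGroup (mapOfEq)

variable {X Y Z : Type*} [TopologicalSpace X] [TopologicalSpace Y] [TopologicalSpace Z]
  {x : X} {y : Y} {z : Z}

/-- The class of a loop in the fundamental group. -/
def loopClass (p : Path x x) : FundamentalGroup X x := .fromPath (.mk p)

theorem loopClass_surjective : Function.Surjective (loopClass (x := x)) :=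
  Path.Homotopic.Quotient.mk_surjective

theorem loopClass_eq_iff_joined {p q : Path x x} : loopClass p = loopClass q ↔ Joined p q :=
  Path.Homotopic.Quotient.eq.trans pathHomotopic_iff_joined

theorem loopClass_refl : loopClass (.refl x) = 1 := rfl

theorem loopClass_eq_one_iff_joined {p : Path x x} : loopClass p = 1 ↔ Joined p (.refl x) :=
  loopClass_eq_iff_joined

theorem mapOfEq_loopClass (f : C(X, Y)) (h : f x = y) (p : Path x x) :
    mapOfEq f h (loopClass p) = loopClass ((p.map f.continuous).cast h.symm h.symm) :=
  FundamentalGroup.mapOfEq_apply f h _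

theorem mapOfEq_id (a : FundamentalGroup X x) : mapOfEq (.id X) rfl a = a := by
  obtain ⟨p, rfl⟩ := loopClass_surjective a
  exact mapOfEq_loopClass _ _ p

theorem mapOfEq_mapOfEq {f : C(X, Y)} {hf : f x = y} {g : C(Y, Z)} {hg : g y = z} {k : C(X, Z)}
    {hk : k x = z} (h : g.comp f = k) (a : FundamentalGroup X x) :
    mapOfEq g hg (mapOfEq f hf a) = mapOfEq k hk a := by
  subst h
  obtain ⟨p, rfl⟩ := loopClass_surjective a
  simp only [mapOfEq_loopClass]
  rfl

theorem mapOfEq_mapOfEq_comm {Y' : Type*} [TopologicalSpace Y'] {y' : Y'} {f : C(X, Y)}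
    {hf : f x = y} {g : C(Y, Z)} {hg : g y = z} {f' : C(X, Y')} {hf' : f' x = y'} {g' : C(Y', Z)}
    {hg' : g' y' = z} (h : g.comp f = g'.comp f') (a : FundamentalGroup X x) :
    mapOfEq g hg (mapOfEq f hf a) = mapOfEq g' hg' (mapOfEq f' hf' a) :=
  (mapOfEq_mapOfEq (hk := by simp [hf', hg']) h a).trans (mapOfEq_mapOfEq rfl a).symm

theorem mapOfEq_mapOfEq_of_comp_eq_id {f : C(X, Y)} {hf : f x = y} {g : C(Y, X)} {hg : g y = x}
    (h : g.comp f = .id X) (a : FundamentalGroup X x) : mapOfEq g hg (mapOfEq f hf a) = a :=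
  (mapOfEq_mapOfEq h a).trans (mapOfEq_id a)

/-- The isomorphism of fundamental groups that is induced by a pointed homeomorphism. -/
noncomputable def fundamentalGroupCongr (e : X ≃ₜ Y) (h : e x = y) :
    FundamentalGroup X x ≃* FundamentalGroup Y y where
  __ := mapOfEq e h
  invFun := mapOfEq e.symm (e.symm_apply_eq.2 h.symm)
  left_inv := mapOfEq_mapOfEq_of_comp_eq_id (by ext; simp)
  right_inv := mapOfEq_mapOfEq_of_comp_eq_id (by ext; simp)

end FundamentalGroup

section FreeLoop

open FundamentalGroup (mapOfEq)

variable {X : Type*} [TopologicalSpace X] {x : X}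

/-- Evaluation of free loops at the base point of the circle. -/
def circleEval : C(C(UnitAddCircle, X), X) := ⟨fun f => f 0, by fun_prop⟩

theorem circleEval_const : circleEval (.const UnitAddCircle x) = x := rfl

theorem pathSwap_map_circleLift (q : Path (Path.refl x) (Path.refl x)) :
    pathSwap UnitAddCircle
        ((q.map circleLift.continuous).cast circleLift_refl.symm circleLift_refl.symm) =
      circleLift (loopTranspose q) :=
  continuousMap_circle_ext fun t => by
    ext s
    simp only [pathSwap_apply, Path.cast_coe, Path.map_coe, Function.comp_apply,
      circleLift_circleLoop]
    rfl

theorem mapOfEq_circleLift_loopClass_eq_iff {q : Path (Path.refl x) (Path.refl x)}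
    {P : Path (ContinuousMap.const UnitAddCircle x) (.const UnitAddCircle x)} :
    mapOfEq circleLift circleLift_refl (loopClass q) = loopClass P ↔
      Joined (circleLift (loopTranspose q)) (pathSwap UnitAddCircle P) := by
  rw [mapOfEq_loopClass, loopClass_eq_iff_joined, ← pathSwap_map_circleLift]
  refine ⟨fun h => h.map (pathSwap UnitAddCircle).continuous, fun h => ?_⟩
  simpa using h.map (pathSwap UnitAddCircle).symm.continuous

theorem mapOfEq_circleLift_injective :
    Function.Injective (mapOfEq circleLift (circleLift_refl (x := x))) := by
  rw [injective_iff_map_eq_one]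
  intro a ha
  obtain ⟨q, rfl⟩ := loopClass_surjective a
  have hq : Joined (circleLift (loopTranspose q)) (.const _ (.refl x)) :=
    mapOfEq_circleLift_loopClass_eq_iff.1 (ha.trans loopClass_refl.symm)
  have hq' : Joined (loopTranspose q) (.refl _) :=
    pathHomotopic_iff_joined.1 (homotopic_refl_of_joined_circleLift_const hq)
  exact loopClass_eq_one_iff_joined.2 (hq'.map loopTranspose.continuous)

theorem mapOfEq_circleEval_mapOfEq_circleLift (a : FundamentalGroup (Path x x) (.refl x)) :
    mapOfEq circleEval circleEval_const (mapOfEq circleLift circleLift_refl a) = 1 := by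
  obtain ⟨q, rfl⟩ := loopClass_surjective a
  rw [mapOfEq_loopClass, mapOfEq_loopClass, ← loopClass_refl]
  congr 1
  ext s
  exact circleLift_zero (q s)

theorem exists_mapOfEq_circleLift_eq {a : FundamentalGroup C(UnitAddCircle, X) (.const _ x)}
    (ha : mapOfEq circleEval circleEval_const a = 1) :
    ∃ b, mapOfEq circleLift circleLift_refl b = a := by
  obtain ⟨P, rfl⟩ := loopClass_surjective a
  rw [mapOfEq_loopClass, loopClass_eq_one_iff_joined] at ha
  obtain ⟨h⟩ := ha
  let p := circleLoop.map (pathSwap UnitAddCircle P).continuous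
  let q : Path (Path.refl x) (Path.refl x) := h.symm.trans (p.trans h)
  have hq : Joined (circleLift p) (circleLift q) := joined_circleLift_conj p h
  rw [circleLift_map_circleLoop] at hq
  exact ⟨loopClass (loopTranspose q), mapOfEq_circleLift_loopClass_eq_iff.2 hq.symm⟩

variable (x) in
/-- The extension `1 → π₁(ΩX) → π₁(LX) → π₁(X) → 1` that is given by the evaluation `LX → X` of
free loops. It is short exact because the constant loops are a section of the evaluation. -/
noncomputable def freeLoopExtension :
    GroupExtension (FundamentalGroup (Path x x) (.refl x))
      (FundamentalGroup C(UnitAddCircle, X) (.const _ x)) (FundamentalGroup X x) where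
  inl := mapOfEq circleLift circleLift_refl
  rightHom := mapOfEq circleEval circleEval_const
  inl_injective := mapOfEq_circleLift_injective
  range_inl_eq_ker_rightHom := by
    ext a
    refine ⟨?_, fun ha => exists_mapOfEq_circleLift_eq ha⟩
    rintro ⟨b, rfl⟩
    exact mapOfEq_circleEval_mapOfEq_circleLift b
  rightHom_surjective a :=
    ⟨mapOfEq ContinuousMap.const' rfl a, mapOfEq_mapOfEq_of_comp_eq_id rfl a⟩

end FreeLoop

section HomotopyGroups

open scoped Topology.Homotopy

variable {X : Type*} [TopologicalSpace X] {x : X}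

/-- Iterated loops in the loop space are iterated loops with one more coordinate, which is put in
front. -/
def genLoopLoopHomeomorph (k : ℕ) (x : X) :
    Ω^ (Fin k) (Path x x) (.refl x) ≃ₜ Ω^ (Fin (k + 1)) X x where
  toFun p :=
    ⟨⟨fun t => p (Fin.tail t) (t 0), by fun_prop⟩, by
      rintro t ⟨i, hi⟩
      cases i using Fin.cases with
      | zero => rcases hi with hi | hi <;> simp [hi]
      | succ i =>
        exact congrArg (fun γ : Path x x => γ (t 0)) (GenLoop.boundary p (Fin.tail t) ⟨i, hi⟩)⟩
  invFun q :=
    ⟨⟨fun s => ⟨⟨fun t => q (Fin.cons t s), by fun_prop⟩, GenLoop.boundary q _ ⟨0, .inl rfl⟩,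
        GenLoop.boundary q _ ⟨0, .inr rfl⟩⟩,
        Path.continuous_uncurry_iff.1 (by dsimp [Function.HasUncurry.uncurry]; fun_prop)⟩,
      fun s ⟨i, hi⟩ => Path.ext (funext fun t => GenLoop.boundary q _ ⟨i.succ, hi⟩)⟩
  left_inv _ := rfl
  right_inv q := by
    ext t
    exact congrArg q (Fin.cons_self_tail t)
  continuous_toFun := by
    refine .subtype_mk (ContinuousMap.continuous_of_continuous_uncurry _ ?_) _
    dsimp [Function.uncurry]
    fun_prop
  continuous_invFun := by
    refine .subtype_mk (ContinuousMap.continuous_of_continuous_uncurry _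
      (Path.continuous_uncurry_iff.1 ?_)) _
    dsimp [Function.HasUncurry.uncurry, Function.uncurry]
    fun_prop

/-- The homotopy group of degree `k + 1` is the fundamental group of the `k`-fold loop space. The
coordinate of the outer loop is the one that defines the multiplication of `π_ (k + 1) X x`. -/
noncomputable def homotopyGroupMulEquiv (k : ℕ) (x : X) :
    π_ (k + 1) X x ≃* FundamentalGroup (Ω^ (Fin k) X x) GenLoop.const :=
  let i : Fin (k + 1) := Classical.arbitrary _
  (homotopyGroupEquivFundamentalGroup i).mulEquiv.trans
    (fundamentalGroupCongr (GenLoop.congr x (finSuccAboveEquiv i).symm) rfl)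

/-- The homotopy groups of the loop space are those of the space with the degree shifted. -/
noncomputable def homotopyGroupLoopMulEquiv (k : ℕ) (x : X) :
    π_ (k + 1) (Path x x) (.refl x) ≃* π_ (k + 2) X x :=
  (homotopyGroupMulEquiv k _).trans
    ((fundamentalGroupCongr (genLoopLoopHomeomorph k x) rfl).trans
      (homotopyGroupMulEquiv (k + 1) x).symm)

end HomotopyGroups

section GroupExtensions

variable {N N₂ E E₂ G : Type*} [Group N] [Group N₂] [Group E] [Group E₂] [Group G]

/-- The transport of a group extension along isomorphisms of its first two terms. -/
def groupExtensionCongr (S : GroupExtension N E G) (eN : N₂ ≃* N) (eE : E₂ ≃* E) :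
    GroupExtension N₂ E₂ G where
  inl := (eE.symm.toMonoidHom.comp S.inl).comp eN.toMonoidHom
  rightHom := S.rightHom.comp eE.toMonoidHom
  inl_injective := eE.symm.injective.comp (S.inl_injective.comp eN.injective)
  range_inl_eq_ker_rightHom := by
    ext a
    simpa [eE.symm_apply_eq, ← eN.surjective.exists (p := fun b => S.inl b = eE a)] using
      SetLike.ext_iff.1 S.range_inl_eq_ker_rightHom (eE a)
  rightHom_surjective := S.rightHom_surjective.comp eE.surjective

theorem exists_inl_eq_of_rightHom_eq_one (S : GroupExtension N E G) {a : E}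
    (ha : S.rightHom a = 1) : ∃ b, S.inl b = a :=
  S.range_inl_eq_ker_rightHom.ge ha

theorem nonempty_mulEquiv_right_of_subsingleton_left (S : GroupExtension N E G)
    [Subsingleton N] : Nonempty (E ≃* G) := by
  refine ⟨.ofBijective S.rightHom ⟨(injective_iff_map_eq_one _).2 fun a ha => ?_,
    S.rightHom_surjective⟩⟩
  obtain ⟨b, rfl⟩ := exists_inl_eq_of_rightHom_eq_one S ha
  rw [Subsingleton.elim b 1, map_one]

theorem nonempty_mulEquiv_left_of_subsingleton_right (S : GroupExtension N E G)
    [Subsingleton G] : Nonempty (E ≃* N) :=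
  ⟨.symm <| .ofBijective S.inl ⟨S.inl_injective, fun _ =>
    exists_inl_eq_of_rightHom_eq_one S (Subsingleton.elim _ _)⟩⟩

theorem nonempty_mulEquiv_prod_of_splitting [IsMulCommutative E] {S : GroupExtension N E G}
    (s : S.Splitting) : Nonempty (E ≃* N × G) := by
  have hs : s.conjAct = 1 := by
    ext g n
    refine S.inl_injective (S.inl_conjAct_comm.trans ?_)
    rw [mul_comm', inv_mul_cancel_left]
    rfl
  have e := s.semidirectProductMulEquiv.symm
  rw [hs] at e
  exact ⟨e.trans SemidirectProduct.mulEquivProd⟩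

end GroupExtensions

section TorusGroups

open FundamentalGroup (mapOfEq)

variable {X : Type*} [TopologicalSpace X] {x : X} {m : ℕ}

/-- The fundamental group of the space of maps from the `m`-torus. This is the Fox torus homotopy
group of degree `m + 1`; the indexing by the dimension of the torus avoids subtractions. -/
abbrev TorusGroup (m : ℕ) (X : Type*) [TopologicalSpace X] (x : X) :=
  FundamentalGroup C(UnitAddTorus (Fin m), X) (.const _ x)

/-- Splitting off the first coordinate of a torus. -/
def torusSucc (m : ℕ) :
    UnitAddTorus (Fin (m + 1)) ≃ₜ UnitAddCircle × UnitAddTorus (Fin m) where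
  toEquiv := (Fin.consEquiv fun _ => UnitAddCircle).symm
  continuous_toFun := by dsimp [Fin.consEquiv]; fun_prop
  continuous_invFun := by dsimp [Fin.consEquiv]; fun_prop

/-- Maps from the `(m + 1)`-torus are free loops in the space of maps from the `m`-torus. -/
def torusCurry (m : ℕ) (X : Type*) [TopologicalSpace X] :
    C(UnitAddTorus (Fin (m + 1)), X) ≃ₜ C(UnitAddCircle, C(UnitAddTorus (Fin m), X)) :=
  ((torusSucc m).arrowCongr (.refl X)).trans .curry

/-- The extension `1 → τ_m(ΩX) → τ_{m+1}(X) → τ_m(X) → 1`, with all degrees raised by one because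
`TorusGroup m` is `τ_{m+1}`. -/
noncomputable def foxExtension (m : ℕ) (X : Type*) [TopologicalSpace X] (x : X) :
    GroupExtension (TorusGroup m (Path x x) (.refl x)) (TorusGroup (m + 1) X x)
      (TorusGroup m X x) :=
  groupExtensionCongr (freeLoopExtension (ContinuousMap.const (UnitAddTorus (Fin m)) x))
    (fundamentalGroupCongr (pathSwap (UnitAddTorus (Fin m))).symm rfl)
    (fundamentalGroupCongr (torusCurry m X) rfl)

/-- The face of the `(m + 1)`-torus on which the coordinate `i` vanishes. -/
def torusFace (i : Fin (m + 1)) : C(UnitAddTorus (Fin m), UnitAddTorus (Fin (m + 1))) :=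
  ⟨fun w => i.insertNth 0 w, by fun_prop⟩

/-- Restriction to a face of the torus. -/
noncomputable def faceHom (i : Fin (m + 1)) : TorusGroup (m + 1) X x →* TorusGroup m X x :=
  mapOfEq (ContinuousMap.compRightContinuousMap X (torusFace i)) rfl

theorem torusFace_zero_apply (w : UnitAddTorus (Fin m)) : torusFace 0 w = Fin.cons 0 w :=
  Fin.insertNth_zero' 0 w

theorem torusFace_succ_cons (i : Fin (m + 1)) (z : UnitAddCircle) (w : UnitAddTorus (Fin m)) :
    torusFace i.succ (Fin.cons z w) = Fin.cons z (torusFace i w) :=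
  Fin.insertNth_succ_cons i 0 z w

theorem foxExtension_rightHom_apply (a : TorusGroup (m + 1) X x) :
    (foxExtension m X x).rightHom a = faceHom 0 a := by
  refine mapOfEq_mapOfEq (f := ⟨torusCurry m X, (torusCurry m X).continuous⟩) (hf := rfl)
    (g := circleEval) (hg := circleEval_const) ?_ a
  ext f w
  exact congrArg f (torusFace_zero_apply w).symm

/-- The projection of the torus that forgets the first coordinate. -/
def torusTail (m : ℕ) : C(UnitAddTorus (Fin (m + 1)), UnitAddTorus (Fin m)) :=
  ⟨fun w => Fin.tail w, by fun_prop⟩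

theorem torusTail_comp_torusFace_zero : (torusTail m).comp (torusFace 0) = .id _ :=
  ContinuousMap.ext fun w => by simp [torusTail, torusFace]

/-- Precomposition with the projection of the torus that forgets the first coordinate. -/
noncomputable def torusTailHom (m : ℕ) (X : Type*) [TopologicalSpace X] (x : X) :
    TorusGroup m X x →* TorusGroup (m + 1) X x :=
  mapOfEq (ContinuousMap.compRightContinuousMap X (torusTail m)) rfl

/-- The splitting of the Fox extension by `torusTailHom`. -/
noncomputable def foxSplitting (m : ℕ) (X : Type*) [TopologicalSpace X] (x : X) :
    (foxExtension m X x).Splitting where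
  __ := torusTailHom m X x
  rightInverse_rightHom := fun a => by
    refine (foxExtension_rightHom_apply _).trans (mapOfEq_mapOfEq_of_comp_eq_id ?_ a)
    ext f w
    exact congrArg f (DFunLike.congr_fun torusTail_comp_torusFace_zero w)

/-- The map that turns tori of loops into tori of one dimension more. -/
noncomputable def torusLift (m : ℕ) (x : X) :
    C(C(UnitAddTorus (Fin m), Path x x), C(UnitAddTorus (Fin (m + 1)), X)) :=
  ⟨fun f => (torusCurry m X).symm (circleLift ((pathSwap (UnitAddTorus (Fin m))).symm f)),
    by fun_prop⟩

theorem torusLift_cons (f : C(UnitAddTorus (Fin m), Path x x)) (z : UnitAddCircle)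
    (w : UnitAddTorus (Fin m)) : torusLift m x f (Fin.cons z w) = circleLift (f w) z := by
  obtain ⟨t, rfl⟩ := circleLoop_surjective z
  rw [circleLift_circleLoop]
  exact DFunLike.congr_fun (circleLift_circleLoop ((pathSwap _).symm f) t) w

theorem torusLift_const : torusLift m x (.const _ (.refl x)) = .const _ x := by
  ext w
  induction w using Fin.consCases with
  | _ z w => exact (torusLift_cons _ z w).trans (DFunLike.congr_fun circleLift_refl z)

theorem foxExtension_inl_apply (a : TorusGroup m (Path x x) (.refl x)) :
    (foxExtension m X x).inl a = mapOfEq (torusLift m x) torusLift_const a := by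
  let e : C(C(UnitAddTorus (Fin m), Path x x), Path (ContinuousMap.const _ x) (.const _ x)) :=
    ⟨_, (pathSwap (UnitAddTorus (Fin m))).symm.continuous⟩
  let e' : C(C(UnitAddCircle, C(UnitAddTorus (Fin m), X)), C(UnitAddTorus (Fin (m + 1)), X)) :=
    ⟨_, (torusCurry m X).symm.continuous⟩
  have h : mapOfEq circleLift circleLift_refl (mapOfEq e rfl a) =
      mapOfEq (circleLift.comp e) circleLift_refl a := mapOfEq_mapOfEq rfl a
  exact (congrArg (mapOfEq e' rfl) h).trans (mapOfEq_mapOfEq rfl a)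

theorem faceHom_succ_foxExtension_inl (i : Fin (m + 1))
    (a : TorusGroup (m + 1) (Path x x) (.refl x)) :
    faceHom i.succ ((foxExtension (m + 1) X x).inl a) =
      (foxExtension m X x).inl (faceHom i a) := by
  rw [foxExtension_inl_apply, foxExtension_inl_apply]
  refine mapOfEq_mapOfEq_comm ?_ a
  ext f w
  induction w using Fin.consCases with
  | _ z w => simp [torusLift_cons, torusFace_succ_cons]

end TorusGroups

section TorusGroupComputations

variable {X : Type*} [TopologicalSpace X] {x : X} {m : ℕ}

/-- In degree one, the torus homotopy group is the first homotopy group. -/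
noncomputable def torusGroupZeroMulEquiv (X : Type*) [TopologicalSpace X] (x : X) :
    TorusGroup 0 X x ≃* π_ 1 X x :=
  .trans
    (fundamentalGroupCongr (.continuousMapOfUnique (X := UnitAddTorus (Fin 0))) rfl).symm
    HomotopyGroup.pi1MulEquivFundamentalGroup.symm

theorem exists_foxExtension_inl_eq {a : TorusGroup (m + 1) X x} (ha : faceHom 0 a = 1) :
    ∃ b, (foxExtension m X x).inl b = a :=
  exists_inl_eq_of_rightHom_eq_one _ ((foxExtension_rightHom_apply a).trans ha)

theorem eq_one_of_faceHom_eq_one [Subsingleton (π_ (m + 2) X x)] {a : TorusGroup (m + 1) X x}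
    (ha : ∀ i, faceHom i a = 1) : a = 1 := by
  induction m generalizing X x with
  | zero =>
    obtain ⟨b, rfl⟩ := exists_foxExtension_inl_eq (ha 0)
    have : Subsingleton (TorusGroup 0 (Path x x) (.refl x)) :=
      ((torusGroupZeroMulEquiv _ _).trans (homotopyGroupLoopMulEquiv 0 x)).subsingleton
    rw [Subsingleton.elim b 1, map_one]
  | succ m ih =>
    obtain ⟨b, rfl⟩ := exists_foxExtension_inl_eq (ha 0)
    have : Subsingleton (π_ (m + 2) (Path x x) (.refl x)) :=
      (homotopyGroupLoopMulEquiv (m + 1) x).subsingleton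
    have hb (i : Fin (m + 1)) : faceHom i b = 1 := by
      apply (foxExtension m X x).inl_injective
      rw [← faceHom_succ_foxExtension_inl, ha, map_one]
    rw [ih hb, map_one]

theorem isMulCommutative_torusGroup_succ [Subsingleton (π_ (m + 2) X x)]
    [IsMulCommutative (TorusGroup m X x)] : IsMulCommutative (TorusGroup (m + 1) X x) :=
  .of_comm fun a b => commutatorElement_eq_one_iff_mul_comm.1 <|
    eq_one_of_faceHom_eq_one fun i => by
      rw [map_commutatorElement, commutatorElement_eq_one_iff_mul_comm, mul_comm']

theorem nonempty_torusGroup_mulEquiv_homotopyGroup (hX : ∀ k < m, Subsingleton (π_ (k + 1) X x)) :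
    Nonempty (TorusGroup m X x ≃* π_ (m + 1) X x) := by
  induction m generalizing X x with
  | zero => exact ⟨torusGroupZeroMulEquiv X x⟩
  | succ m ih =>
    obtain ⟨e⟩ := ih fun k hk => hX k (hk.trans m.lt_succ_self)
    have : Subsingleton (π_ (m + 1) X x) := hX m m.lt_succ_self
    have : Subsingleton (TorusGroup m X x) := e.subsingleton
    obtain ⟨e'⟩ := nonempty_mulEquiv_left_of_subsingleton_right (foxExtension m X x)
    obtain ⟨f⟩ := ih (X := Path x x) (x := .refl x) fun k hk =>
      have : Subsingleton (π_ (k + 2) X x) := hX (k + 1) (Nat.succ_lt_succ hk)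
      (homotopyGroupLoopMulEquiv k x).subsingleton
    exact ⟨(e'.trans f).trans (homotopyGroupLoopMulEquiv m x)⟩

theorem subsingleton_torusGroup (hX : ∀ k ≤ m, Subsingleton (π_ (k + 1) X x)) :
    Subsingleton (TorusGroup m X x) := by
  obtain ⟨e⟩ := nonempty_torusGroup_mulEquiv_homotopyGroup fun k hk => hX k hk.le
  have : Subsingleton (π_ (m + 1) X x) := hX m le_rfl
  exact e.subsingleton

theorem isMulCommutative_torusGroup {r : ℕ} (hX : ∀ k ≠ r + 1, Subsingleton (π_ (k + 1) X x)) :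
    IsMulCommutative (TorusGroup m X x) := by
  induction m with
  | zero =>
    have : Subsingleton (TorusGroup 0 X x) := subsingleton_torusGroup fun k hk => hX k (by omega)
    infer_instance
  | succ m ih =>
    rcases le_or_gt m r with hmr | hmr
    · obtain ⟨e⟩ := nonempty_torusGroup_mulEquiv_homotopyGroup (m := m + 1)
        fun k hk => hX k (by omega)
      exact .of_comm fun a b => e.injective (by rw [map_mul, map_mul, mul_comm])
    · have : Subsingleton (π_ (m + 2) X x) := hX (m + 1) (by omega)
      exact isMulCommutative_torusGroup_succ

theorem nonempty_torusGroup_mulEquiv_of_aspherical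
    (hX : ∀ k ≠ 0, Subsingleton (π_ (k + 1) X x)) :
    Nonempty (TorusGroup m X x ≃* π_ 1 X x) := by
  induction m with
  | zero => exact ⟨torusGroupZeroMulEquiv X x⟩
  | succ m ih =>
    have : Subsingleton (TorusGroup m (Path x x) (.refl x)) := subsingleton_torusGroup fun k _ =>
      have : Subsingleton (π_ (k + 2) X x) := hX (k + 1) k.succ_ne_zero
      (homotopyGroupLoopMulEquiv k x).subsingleton
    obtain ⟨e⟩ := nonempty_mulEquiv_right_of_subsingleton_left (foxExtension m X x)
    exact ih.map e.trans

theorem subsingleton_homotopyGroup_path {r : ℕ}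
    (hX : ∀ k ≠ r + 1, Subsingleton (π_ (k + 1) X x)) {k : ℕ} (hk : k ≠ r) :
    Subsingleton (π_ (k + 1) (Path x x) (.refl x)) :=
  have : Subsingleton (π_ (k + 2) X x) := hX (k + 1) (by omega)
  (homotopyGroupLoopMulEquiv k x).subsingleton

/-- Appending tuples, as an isomorphism of groups. -/
def appendMulEquiv (a b : ℕ) (G : Type*) [Group G] :
    (Fin a → G) × (Fin b → G) ≃* (Fin (a + b) → G) where
  __ := Fin.appendEquiv a b
  map_mul' f g := by
    ext i
    induction i using Fin.addCases <;> simp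

theorem nonempty_torusGroup_succ_mulEquiv_prod {r : ℕ}
    (hX : ∀ k ≠ r + 1, Subsingleton (π_ (k + 1) X x)) :
    Nonempty (TorusGroup (m + 1) X x ≃*
      TorusGroup m (Path x x) (.refl x) × TorusGroup m X x) :=
  have : IsMulCommutative (TorusGroup (m + 1) X x) := isMulCommutative_torusGroup hX
  nonempty_mulEquiv_prod_of_splitting (foxSplitting m X x)

theorem nonempty_torusGroup_mulEquiv_pi {r : ℕ} (hX : ∀ k ≠ r, Subsingleton (π_ (k + 1) X x)) :
    Nonempty (TorusGroup m X x ≃* (Fin (m.choose r) → π_ (r + 1) X x)) := by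
  induction m generalizing r X x with
  | zero =>
    cases r with
    | zero => exact ⟨(torusGroupZeroMulEquiv X x).trans
        (MulEquiv.piUnique fun _ : Fin 1 => π_ 1 X x).symm⟩
    | succ r =>
      have : Subsingleton (TorusGroup 0 X x) := subsingleton_torusGroup fun k hk => hX k (by omega)
      have : Unique (TorusGroup 0 X x) := uniqueOfSubsingleton 1
      rw [Nat.choose_zero_succ]
      exact ⟨MulEquiv.ofUnique⟩
  | succ m ih =>
    cases r with
    | zero =>
      rw [Nat.choose_zero_right]
      exact (nonempty_torusGroup_mulEquiv_of_aspherical hX).map fun e =>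
        e.trans (MulEquiv.piUnique fun _ : Fin 1 => π_ 1 X x).symm
    | succ r =>
      obtain ⟨e⟩ := nonempty_torusGroup_succ_mulEquiv_prod (m := m) hX
      obtain ⟨e₁⟩ := ih (X := Path x x) (x := .refl x) fun _ => subsingleton_homotopyGroup_path hX
      obtain ⟨e₂⟩ := ih hX
      let f := e₁.trans (MulEquiv.arrowCongr (.refl _) (homotopyGroupLoopMulEquiv r x))
      rw [Nat.choose_succ_succ]
      exact ⟨(e.trans (f.prodCongr e₂)).trans (appendMulEquiv _ _ _)⟩

end TorusGroupComputations

theorem sum_range_choose_sub_two {n : ℕ} (hn : 2 ≤ n) (k : ℕ) :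
    ∑ j ∈ Finset.range (k + 1), (n - 2 + j).choose (n - 2) = (n + k - 1).choose k := by
  simp only [add_comm (n - 2)]
  rw [Nat.sum_range_add_choose, show n + k - 1 = k + (n - 2 + 1) by omega, Nat.choose_symm_add,
    add_assoc]

/-- Functions on a disjoint union of the sets `Fin (c j)` are families of functions. -/
noncomputable def piSigmaMulEquiv {k : ℕ} (c : Fin k → ℕ) (G : Type*) [Group G] :
    (Fin (∑ j, c j) → G) ≃* (∀ j, Fin (c j) → G) :=
  (MulEquiv.arrowCongr finSigmaFinEquiv.symm (.refl G)).trans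
    { Equiv.piCurry fun j (_ : Fin (c j)) => G with map_mul' := fun _ _ => rfl }

section EilenbergMacLane

variable {X : Type*} [TopologicalSpace X] {x : X} {n m : ℕ}

theorem nonempty_foxTorusGroup_mulEquiv_homotopyGroup [NeZero m]
    (hX : ∀ (k : ℕ) [NeZero k], k < m → Subsingleton (π_ k X x)) :
    Nonempty (FoxTorusGroup m X x ≃* π_ m X x) := by
  obtain ⟨m, rfl⟩ := Nat.exists_eq_succ_of_ne_zero (NeZero.ne m)
  exact nonempty_torusGroup_mulEquiv_homotopyGroup fun k hk => hX (k + 1) (by omega)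

theorem nonempty_foxTorusGroup_mulEquiv_pi [NeZero n] (hnm : n ≤ m)
    (hX : ∀ (k : ℕ) [NeZero k], k ≠ n → Subsingleton (π_ k X x)) :
    Nonempty (FoxTorusGroup m X x ≃* (Fin ((m - 1).choose (m - n)) → π_ n X x)) := by
  obtain ⟨r, rfl⟩ := Nat.exists_eq_succ_of_ne_zero (NeZero.ne n)
  rw [show m - r.succ = m - 1 - r by omega, Nat.choose_symm (by omega)]
  exact nonempty_torusGroup_mulEquiv_pi fun k hk => hX (k + 1) (by omega)

end EilenbergMacLane

theorem mainTheorem11_general {X : Type u} [TopologicalSpace X] (x₀ : X) :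
    (∀ (n : ℕ) [NeZero n] (G : Type v) [Group G], 2 ≤ n → Nonempty (π_ n X x₀ ≃* G) →
      (∀ (k : ℕ) [NeZero k], k ≠ n → Subsingleton (π_ k X x₀)) →
      (∀ (m : ℕ) [NeZero m], m ≤ n → Nonempty (FoxTorusGroup m X x₀ ≃* π_ m X x₀)) ∧
      (∀ m : ℕ, 1 ≤ m → m < n → Subsingleton (FoxTorusGroup m X x₀)) ∧
      (∀ k : ℕ, Nonempty (FoxTorusGroup (n + k) X x₀ ≃*
        ((j : Fin (k + 1)) → Fin ((n - 2 + (j : ℕ)).choose (n - 2)) → π_ n X x₀))) ∧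
      (∀ k : ℕ, ∑ j ∈ Finset.range (k + 1), (n - 2 + j).choose (n - 2) =
        (n + k - 1).choose k) ∧
      (∀ m : ℕ, n ≤ m →
        Nonempty (FoxTorusGroup m X x₀ ≃* (Fin ((m - 1).choose (m - n)) → G)))) ∧
    (∀ (G : Type v) [Group G], Nonempty (π_ 1 X x₀ ≃* G) →
      (∀ (k : ℕ) [NeZero k], k ≠ 1 → Subsingleton (π_ k X x₀)) →
      ∀ k : ℕ, 1 ≤ k → Nonempty (FoxTorusGroup k X x₀ ≃* G)) := by
  refine ⟨fun n _ G _ hn ⟨f⟩ hX => ⟨fun m _ hm => ?_, fun m h0 hm => ?_, fun k => ?_,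
    sum_range_choose_sub_two hn, fun m hm => ?_⟩, fun G _ ⟨f⟩ hX k _ => ?_⟩
  · exact nonempty_foxTorusGroup_mulEquiv_homotopyGroup fun k _ hk => hX k (hk.trans_le hm).ne
  · have : NeZero m := ⟨by omega⟩
    obtain ⟨e⟩ := nonempty_foxTorusGroup_mulEquiv_homotopyGroup fun k _ hk =>
      hX k (hk.trans hm).ne
    have : Subsingleton (π_ m X x₀) := hX m hm.ne
    exact e.subsingleton
  · obtain ⟨e⟩ := nonempty_foxTorusGroup_mulEquiv_pi (Nat.le_add_right n k) hX
    rw [Nat.add_sub_cancel_left, ← sum_range_choose_sub_two hn, Finset.sum_range] at e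
    exact ⟨e.trans (piSigmaMulEquiv _ _)⟩
  · obtain ⟨e⟩ := nonempty_foxTorusGroup_mulEquiv_pi hm hX
    exact ⟨e.trans (MulEquiv.arrowCongr (.refl _) f)⟩
  · obtain ⟨e⟩ := nonempty_torusGroup_mulEquiv_of_aspherical (m := k - 1) fun j hj =>
      hX (j + 1) (by omega)
    exact ⟨e.trans f⟩

theorem mainTheorem11 {X : Type u} [TopologicalSpace X] (x₀ : X) :
    -- the case `n ≥ 2`, for an abelian group `G`
    (∀ (n : ℕ) [NeZero n] (G : Type v) [CommGroup G], 2 ≤ n → IsEilenbergMacLane G n X →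
      -- `τ_m(X) ≅ π_m(X)` for `1 ≤ m ≤ n`
      (∀ (m : ℕ) [NeZero m], m ≤ n → Nonempty (FoxTorusGroup m X x₀ ≃* π_ m X x₀)) ∧
      -- `τ_m(X)` is trivial for `1 ≤ m < n`
      (∀ m : ℕ, 1 ≤ m → m < n → Subsingleton (FoxTorusGroup m X x₀)) ∧
      -- `τ_{n+k}(X)` is the direct sum of the `π_n(X)^{C(n-2+j, n-2)}`, `0 ≤ j ≤ k`
      (∀ k : ℕ, Nonempty (FoxTorusGroup (n + k) X x₀ ≃*
        ((j : Fin (k + 1)) → Fin ((n - 2 + (j : ℕ)).choose (n - 2)) → π_ n X x₀))) ∧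
      -- the number of summands is `C(n+k-1, k)`
      (∀ k : ℕ, ∑ j ∈ Finset.range (k + 1), (n - 2 + j).choose (n - 2) =
        (n + k - 1).choose k) ∧
      -- `τ_m(X) ≅ G^{C(m-1, m-n)}` for `m ≥ n`
      (∀ m : ℕ, n ≤ m →
        Nonempty (FoxTorusGroup m X x₀ ≃* (Fin ((m - 1).choose (m - n)) → G)))) ∧
    -- the case `n = 1`, for an arbitrary group `G`
    (∀ (G : Type v) [Group G], IsEilenbergMacLane G 1 X →
      ∀ k : ℕ, 1 ≤ k → Nonempty (FoxTorusGroup k X x₀ ≃* G)) :=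
  ⟨fun n _ G _ hn h => (mainTheorem11_general x₀).1 n G hn (h.nonempty_mulEquiv x₀) fun k _ hk =>
      h.subsingleton_of_ne k hk x₀,
    fun G _ h => (mainTheorem11_general x₀).2 G (h.nonempty_mulEquiv x₀) fun k _ hk =>
      h.subsingleton_of_ne k hk x₀⟩
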